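/- A unital Abelian $\ell$-group is an Abelian group $G$ with a translation-invariant lattice order and a distinguished element $1\in G$, $1\ge 0$, such that for every $a\in G$ there is $n\in\mathbb N$ with $a\le n1$. A unital $\ell$-homomorphism is a group and lattice homomorphism preserving $1$, and an isomorphism is a unital $\ell$-homomorphism with a two-sided inverse unital $\ell$-homomorphism. A state $s\colon G\to H$ between unital Abelian $\ell$-groups is a group homomorphism with $s(1)=1$ and $s(a)\ge 0$ whenever $a\ge 0$. A state $\upsilon_G\colon G\to\Upsilon G$ is universal if for every state $s\colon G\to H$ there is exactly one unital $\ell$-homomorphism $h\colon\Upsilon G\to H$ with $h\upsilon_G=s$; every unital Abelian $\ell$-group has a universal state, unique up to a unique isomorphism. Let $\mathrm{St}\,G\subseteq\mathbb R^G$ be the set of states $G\to\mathbb R$, with the subspace topology of the product topology, and for $a\in G$ let $\hat a\colon \mathrm{St}\,G\to\mathbb R$, $\hat a(s)=s(a)$. Let $\widehat G$ be the sublattice-subgroup of the continuous real-valued functions $C(\mathrm{St}\,G)$ (with pointwise operations and order, and unit the constant function $1$) generated by $\{\hat a\mid a\in G\}$; the map $e_G\colon G\to\widehat G$, $a\mapsto\hat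 a$, is a state. $G$ is Archimedean if, for all $a,b\in G$, $na\le b$ for all integers $n\ge 1$ implies $a\le 0$. **Proposition.** Let $G$ be a unital Abelian $\ell$-group, let $\upsilon_G\colon G\to\Upsilon G$ be a universal state of $G$, and let $q_G\colon\Upsilon G\to\widehat G$ be the unique unital $\ell$-homomorphism with $q_G\upsilon_G=e_G$. Then $q_G$ is an isomorphism if and only if $\Upsilon G$ is Archimedean. -/

import Mathlib

universe u v w

/-- A unital Abelian ℓ-group: a lattice-ordered Abelian group (translation-invariant lattice order)
with a distinguished strong order unit. The one-element group is allowed. -/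
class UnitalLGroup (G : Type u) extends AddCommGroup G, Lattice G, IsOrderedAddMonoid G where
  /-- the distinguished unit -/
  unit : G
  unit_nonneg : 0 ≤ unit
  exists_le_nsmul_unit : ∀ a : G, ∃ n : ℕ, a ≤ n • unit

namespace UnitalLGroup

/-- The real numbers, with unit `1`. -/
noncomputable instance instReal : UnitalLGroup ℝ where
  unit := 1
  unit_nonneg := zero_le_one
  exists_le_nsmul_unit a := by
    obtain ⟨n, hn⟩ := exists_nat_ge a
    exact ⟨n, by simpa using hn⟩

/-- A state of `G` with values in `H`: a positive group homomorphism that preserves the unit. -/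
structure IsState {G : Type u} {H : Type v} [UnitalLGroup G] [UnitalLGroup H] (s : G → H) :
    Prop where
  map_add : ∀ a b, s (a + b) = s a + s b
  map_unit : s unit = unit
  map_nonneg : ∀ a, 0 ≤ a → 0 ≤ s a

/-- A unital ℓ-homomorphism: a homomorphism of groups and of lattices that preserves the unit. -/
structure IsUnitalLHom {G : Type u} {H : Type v} [UnitalLGroup G] [UnitalLGroup H] (h : G → H) :
    Prop where
  map_add : ∀ a b, h (a + b) = h a + h b
  map_sup : ∀ a b, h (a ⊔ b) = h a ⊔ h b
  map_inf : ∀ a b, h (a ⊓ b) = h a ⊓ h b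
  map_unit : h unit = unit

/-- An isomorphism of unital Abelian ℓ-groups: a unital ℓ-homomorphism with a two-sided inverse
unital ℓ-homomorphism. -/
def IsUnitalLIso {G : Type u} {H : Type v} [UnitalLGroup G] [UnitalLGroup H] (h : G → H) : Prop :=
  IsUnitalLHom h ∧ ∃ k : H → G, IsUnitalLHom k ∧ (∀ a, k (h a) = a) ∧ ∀ b, h (k b) = b

/-- `G` is Archimedean if `n a ≤ b` for all positive integers `n` implies `a ≤ 0`. -/
def IsArchimedean (G : Type u) [UnitalLGroup G] : Prop :=
  ∀ a b : G, (∀ n : ℕ, 0 < n → n • a ≤ b) → a ≤ 0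

/-- A state `υ : G → U` is universal if every state of `G` factors through it by exactly one
unital ℓ-homomorphism. -/
structure IsUniversalState {G U : Type u} [UnitalLGroup G] [UnitalLGroup U] (υ : G → U) :
    Prop where
  isState : IsState υ
  existsUnique_hom : ∀ (H : Type u) [UnitalLGroup H] (s : G → H), IsState s →
    ∃! h : U → H, IsUnitalLHom h ∧ ∀ a, h (υ a) = s a

section Bounds

variable {L : Type w} [AddCommGroup L] [Lattice L] [IsOrderedAddMonoid L]

/-- `x` lies between two integer multiples of `e`. -/
def BoundedBy (e x : L) : Prop := ∃ n : ℕ, -(n • e) ≤ x ∧ x ≤ n • e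

theorem BoundedBy.zero {L : Type w} [AddCommGroup L] [Lattice L] (e : L) : BoundedBy e 0 :=
  ⟨0, by simp⟩

theorem BoundedBy.add {e x y : L} (hx : BoundedBy e x) (hy : BoundedBy e y) :
    BoundedBy e (x + y) := by
  obtain ⟨n, h1, h2⟩ := hx
  obtain ⟨m, h3, h4⟩ := hy
  refine ⟨n + m, ?_, ?_⟩
  · rw [add_nsmul, neg_add]; exact add_le_add h1 h3
  · rw [add_nsmul]; exact add_le_add h2 h4

theorem BoundedBy.neg {e x : L} (hx : BoundedBy e x) : BoundedBy e (-x) := by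
  obtain ⟨n, h1, h2⟩ := hx
  exact ⟨n, neg_le_neg h2, neg_le.1 h1⟩

theorem BoundedBy.common {e x y : L} (he : 0 ≤ e) (hx : BoundedBy e x) (hy : BoundedBy e y) :
    ∃ n : ℕ, (-(n • e) ≤ x ∧ x ≤ n • e) ∧ (-(n • e) ≤ y ∧ y ≤ n • e) := by
  obtain ⟨n, h1, h2⟩ := hx
  obtain ⟨m, h3, h4⟩ := hy
  have hn : n • e ≤ (n + m) • e := nsmul_le_nsmul_left he (Nat.le_add_right n m)
  have hm : m • e ≤ (n + m) • e := nsmul_le_nsmul_left he (Nat.le_add_left m n)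
  exact ⟨n + m, ⟨(neg_le_neg hn).trans h1, h2.trans hn⟩, ⟨(neg_le_neg hm).trans h3, h4.trans hm⟩⟩

theorem BoundedBy.sup {e x y : L} (he : 0 ≤ e) (hx : BoundedBy e x) (hy : BoundedBy e y) :
    BoundedBy e (x ⊔ y) := by
  obtain ⟨n, ⟨h1, h2⟩, -, h4⟩ := BoundedBy.common he hx hy
  exact ⟨n, h1.trans le_sup_left, sup_le h2 h4⟩

theorem BoundedBy.inf {e x y : L} (he : 0 ≤ e) (hx : BoundedBy e x) (hy : BoundedBy e y) :
    BoundedBy e (x ⊓ y) := by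
  obtain ⟨n, ⟨h1, h2⟩, h3, -⟩ := BoundedBy.common he hx hy
  exact ⟨n, le_inf h1 h3, inf_le_left.trans h2⟩

end Bounds

theorem IsState.map_zero {G : Type u} {H : Type v} [UnitalLGroup G] [UnitalLGroup H] {s : G → H}
    (hs : IsState s) : s 0 = 0 := by
  simpa using hs.map_add 0 0

theorem IsState.map_neg {G : Type u} {H : Type v} [UnitalLGroup G] [UnitalLGroup H] {s : G → H}
    (hs : IsState s) (a : G) : s (-a) = -s a := by
  have h := hs.map_add (-a) a
  rw [neg_add_cancel, hs.map_zero] at h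
  exact eq_neg_of_add_eq_zero_left h.symm

theorem IsState.map_nsmul {G : Type u} {H : Type v} [UnitalLGroup G] [UnitalLGroup H] {s : G → H}
    (hs : IsState s) (n : ℕ) (a : G) : s (n • a) = n • s a := by
  induction n with
  | zero => simpa using hs.map_zero
  | succ k ih => rw [succ_nsmul, succ_nsmul, hs.map_add, ih]

theorem IsState.mono {G : Type u} {H : Type v} [UnitalLGroup G] [UnitalLGroup H] {s : G → H}
    (hs : IsState s) {a b : G} (h : a ≤ b) : s a ≤ s b := by
  have h1 := hs.map_nonneg (b - a) (sub_nonneg.2 h)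
  rw [sub_eq_add_neg, hs.map_add, hs.map_neg, ← sub_eq_add_neg] at h1
  exact sub_nonneg.1 h1

theorem boundedBy_unit {G : Type u} [UnitalLGroup G] (a : G) : BoundedBy (unit : G) a := by
  obtain ⟨n, hn⟩ := exists_le_nsmul_unit a
  obtain ⟨m, hm⟩ := exists_le_nsmul_unit (-a)
  have h1 : n • (unit : G) ≤ (n + m) • unit :=
    nsmul_le_nsmul_left unit_nonneg (Nat.le_add_right n m)
  have h2 : m • (unit : G) ≤ (n + m) • unit :=
    nsmul_le_nsmul_left unit_nonneg (Nat.le_add_left m n)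
  exact ⟨n + m, neg_le.1 (hm.trans h2), hn.trans h1⟩

/-! ### The state space and the extended affine representation -/

/-- The state space of `G`: the real-valued states, as a subset of the product space `G → ℝ`
(and so with the subspace topology of the product topology). -/
def stateSpace (G : Type u) [UnitalLGroup G] : Set (G → ℝ) := {s | IsState s}

/-- The continuous function `s ↦ s a` on the state space. -/
def hat {G : Type u} [UnitalLGroup G] (a : G) : C(stateSpace G, ℝ) where
  toFun s := s.1 a
  continuous_toFun := (continuous_apply a).comp continuous_subtype_val

/-- The sublattice-subgroup of `C(stateSpace G, ℝ)` generated by the functions `hat a`: the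
intersection of all subgroups that are closed under binary suprema and infima and contain every
`hat a`. -/
def extAffine (G : Type u) [UnitalLGroup G] : AddSubgroup C(stateSpace G, ℝ) :=
  sInf {K | (∀ f ∈ K, ∀ g ∈ K, f ⊔ g ∈ K) ∧ (∀ f ∈ K, ∀ g ∈ K, f ⊓ g ∈ K) ∧ ∀ a : G, hat a ∈ K}

section ExtAffine

variable {G : Type u} [UnitalLGroup G]

theorem hat_mem (a : G) : hat a ∈ extAffine G :=
  AddSubgroup.mem_sInf.2 fun _ hK => hK.2.2 a

theorem sup_mem_extAffine {f g : C(stateSpace G, ℝ)} (hf : f ∈ extAffine G)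
    (hg : g ∈ extAffine G) : f ⊔ g ∈ extAffine G :=
  AddSubgroup.mem_sInf.2 fun K hK =>
    hK.1 f (AddSubgroup.mem_sInf.1 hf K hK) g (AddSubgroup.mem_sInf.1 hg K hK)

theorem inf_mem_extAffine {f g : C(stateSpace G, ℝ)} (hf : f ∈ extAffine G)
    (hg : g ∈ extAffine G) : f ⊓ g ∈ extAffine G :=
  AddSubgroup.mem_sInf.2 fun K hK =>
    hK.2.1 f (AddSubgroup.mem_sInf.1 hf K hK) g (AddSubgroup.mem_sInf.1 hg K hK)

theorem hat_unit : hat (unit : G) = 1 := by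
  ext s
  exact s.2.map_unit

theorem hat_boundedBy (a : G) : BoundedBy (1 : C(stateSpace G, ℝ)) (hat a) := by
  obtain ⟨n, h1, h2⟩ := boundedBy_unit a
  refine ⟨n, fun s => ?_, fun s => ?_⟩
  · have h := s.2.mono h1
    rw [s.2.map_neg, s.2.map_nsmul, s.2.map_unit] at h
    exact h
  · have h := s.2.mono h2
    rw [s.2.map_nsmul, s.2.map_unit] at h
    exact h

theorem extAffine_boundedBy {f : C(stateSpace G, ℝ)} (hf : f ∈ extAffine G) :
    BoundedBy (1 : C(stateSpace G, ℝ)) f := by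
  have h01 : (0 : C(stateSpace G, ℝ)) ≤ 1 := fun _ => zero_le_one
  let K : AddSubgroup C(stateSpace G, ℝ) :=
    { carrier := {f | BoundedBy 1 f}
      add_mem' := BoundedBy.add
      zero_mem' := BoundedBy.zero 1
      neg_mem' := BoundedBy.neg }
  exact AddSubgroup.mem_sInf.1 hf K
    ⟨fun _ hf _ hg => BoundedBy.sup h01 hf hg, fun _ hf _ hg => BoundedBy.inf h01 hf hg,
      hat_boundedBy⟩

/-- The pointwise lattice order on the generated sublattice-subgroup. -/
noncomputable instance instLatticeExtAffine : Lattice (extAffine G) :=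
  Subtype.lattice (fun _ _ => sup_mem_extAffine) (fun _ _ => inf_mem_extAffine)

/-- The generated sublattice-subgroup as a unital Abelian ℓ-group with pointwise operations; its
unit is the constant function `1`. -/
noncomputable instance instExtAffine : UnitalLGroup (extAffine G) where
  toAddCommGroup := inferInstance
  toLattice := instLatticeExtAffine
  add_le_add_left f g h k := by
    have h' : (f : C(stateSpace G, ℝ)) ≤ g := h
    exact add_le_add_left h' (k : C(stateSpace G, ℝ))
  unit := ⟨1, hat_unit (G := G) ▸ hat_mem unit⟩
  unit_nonneg := by
    have h01 : (0 : C(stateSpace G, ℝ)) ≤ 1 := fun _ => zero_le_one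
    exact h01
  exists_le_nsmul_unit f := by
    obtain ⟨n, -, h⟩ := extAffine_boundedBy f.2
    exact ⟨n, h⟩

variable (G) in
/-- The extended affine representation of `G`. -/
def extAffineRep (a : G) : extAffine G := ⟨hat a, hat_mem a⟩

theorem isState_extAffineRep : IsState (extAffineRep G) where
  map_add a b := by
    apply Subtype.ext
    ext s
    exact s.2.map_add a b
  map_unit := Subtype.ext hat_unit
  map_nonneg a ha := by
    have h : (0 : C(stateSpace G, ℝ)) ≤ hat a := fun s => s.2.map_nonneg a ha
    exact h

end ExtAffine

/-! ### The comparison homomorphism -/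

section Comparison

variable {G U : Type u} [UnitalLGroup G] [UnitalLGroup U] {υ : G → U}

/-- The comparison map of a universal state `υ : G → U`: the unique unital ℓ-homomorphism
`q : U → extAffine G` with `q ∘ υ = extAffineRep G`. -/
noncomputable def comparison (hυ : IsUniversalState υ) : U → extAffine G :=
  (hυ.existsUnique_hom (extAffine G) (extAffineRep G) isState_extAffineRep).choose

theorem isUnitalLHom_comparison (hυ : IsUniversalState υ) : IsUnitalLHom (comparison hυ) :=
  (hυ.existsUnique_hom (extAffine G) (extAffineRep G) isState_extAffineRep).choose_spec.1.1

theorem comparison_apply (hυ : IsUniversalState υ) (a : G) :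
    comparison hυ (υ a) = extAffineRep G a :=
  (hυ.existsUnique_hom (extAffine G) (extAffineRep G) isState_extAffineRep).choose_spec.1.2 a

theorem comparison_unique (hυ : IsUniversalState υ) {q : U → extAffine G} (hq : IsUnitalLHom q)
    (h : ∀ a, q (υ a) = extAffineRep G a) : q = comparison hυ :=
  (hυ.existsUnique_hom (extAffine G) (extAffineRep G) isState_extAffineRep).choose_spec.2 q ⟨hq, h⟩

end Comparison

/-! ### Construction of a universal state

Every unital Abelian ℓ-group has a universal state, with codomain the ℓ-group presented by
generators `of a`, for `a` in `G`, and relations that make `of` a positive group homomorphism. -/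

/-- ℓ-group terms in the elements of `G`. -/
inductive LTerm (G : Type u) : Type u
  | of : G → LTerm G
  | zero : LTerm G
  | add : LTerm G → LTerm G → LTerm G
  | neg : LTerm G → LTerm G
  | sup : LTerm G → LTerm G → LTerm G
  | inf : LTerm G → LTerm G → LTerm G

/-- The congruence generated by the laws of Abelian ℓ-groups, additivity of `of`, and positivity
of `of`. -/
inductive LTerm.Rel {G : Type u} [UnitalLGroup G] : LTerm G → LTerm G → Prop
  | refl (x) : Rel x x
  | symm {x y} : Rel x y → Rel y x
  | trans {x y z} : Rel x y → Rel y z → Rel x z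
  | add_congr {x x' y y'} : Rel x x' → Rel y y' → Rel (.add x y) (.add x' y')
  | neg_congr {x x'} : Rel x x' → Rel (.neg x) (.neg x')
  | sup_congr {x x' y y'} : Rel x x' → Rel y y' → Rel (.sup x y) (.sup x' y')
  | inf_congr {x x' y y'} : Rel x x' → Rel y y' → Rel (.inf x y) (.inf x' y')
  | add_assoc (x y z) : Rel (.add (.add x y) z) (.add x (.add y z))
  | add_comm (x y) : Rel (.add x y) (.add y x)
  | zero_add (x) : Rel (.add .zero x) x
  | neg_add (x) : Rel (.add (.neg x) x) .zero
  | sup_comm (x y) : Rel (.sup x y) (.sup y x)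
  | sup_assoc (x y z) : Rel (.sup (.sup x y) z) (.sup x (.sup y z))
  | inf_comm (x y) : Rel (.inf x y) (.inf y x)
  | inf_assoc (x y z) : Rel (.inf (.inf x y) z) (.inf x (.inf y z))
  | sup_inf_self (x y) : Rel (.sup x (.inf x y)) x
  | inf_sup_self (x y) : Rel (.inf x (.sup x y)) x
  | sup_add (x y z) : Rel (.add (.sup x y) z) (.sup (.add x z) (.add y z))
  | of_add (a b) : Rel (.of (a + b)) (.add (.of a) (.of b))
  | of_nonneg (a) : 0 ≤ a → Rel (.sup .zero (.of a)) (.of a)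

/-- The codomain of the constructed universal state. -/
def Upsilon (G : Type u) [UnitalLGroup G] : Type u := Quot (LTerm.Rel (G := G))

namespace Upsilon

variable {G : Type u} [UnitalLGroup G]

/-- The class of a term. -/
def mk (t : LTerm G) : Upsilon G := Quot.mk _ t

theorem mk_eq {s t : LTerm G} (h : LTerm.Rel s t) : mk s = mk t := Quot.sound h

instance instZero : Zero (Upsilon G) := ⟨mk .zero⟩

instance instAdd : Add (Upsilon G) :=
  ⟨Quot.map₂ .add (fun _ _ _ h => .add_congr (.refl _) h) (fun _ _ _ h => .add_congr h (.refl _))⟩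

instance instNeg : Neg (Upsilon G) := ⟨Quot.map .neg fun _ _ h => .neg_congr h⟩

instance instMax : Max (Upsilon G) :=
  ⟨Quot.map₂ .sup (fun _ _ _ h => .sup_congr (.refl _) h) (fun _ _ _ h => .sup_congr h (.refl _))⟩

instance instMin : Min (Upsilon G) :=
  ⟨Quot.map₂ .inf (fun _ _ _ h => .inf_congr (.refl _) h) (fun _ _ _ h => .inf_congr h (.refl _))⟩

theorem ind {p : Upsilon G → Prop} (h : ∀ t, p (mk t)) (x : Upsilon G) : p x := Quot.ind h x

instance instAddCommGroup : AddCommGroup (Upsilon G) where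
  add_assoc x y z := by
    induction x using ind; induction y using ind; induction z using ind
    exact mk_eq (.add_assoc _ _ _)
  zero_add x := by
    induction x using ind
    exact mk_eq (.zero_add _)
  add_zero x := by
    induction x using ind
    exact mk_eq (.trans (.add_comm _ _) (.zero_add _))
  nsmul := nsmulRec
  zsmul := zsmulRec
  neg_add_cancel x := by
    induction x using ind
    exact mk_eq (.neg_add _)
  add_comm x y := by
    induction x using ind; induction y using ind
    exact mk_eq (.add_comm _ _)

/-- The order is `x ≤ y ↔ x ⊔ y = y`. -/
instance instLattice : Lattice (Upsilon G) :=
  Lattice.mk'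
    (fun x y => by
      induction x using ind; induction y using ind
      exact mk_eq (.sup_comm _ _))
    (fun x y z => by
      induction x using ind; induction y using ind; induction z using ind
      exact mk_eq (.sup_assoc _ _ _))
    (fun x y => by
      induction x using ind; induction y using ind
      exact mk_eq (.inf_comm _ _))
    (fun x y z => by
      induction x using ind; induction y using ind; induction z using ind
      exact mk_eq (.inf_assoc _ _ _))
    (fun x y => by
      induction x using ind; induction y using ind
      exact mk_eq (.sup_inf_self _ _))
    (fun x y => by
      induction x using ind; induction y using ind
      exact mk_eq (.inf_sup_self _ _))

theorem sup_add' (x y z : Upsilon G) : (x ⊔ y) + z = (x + z) ⊔ (y + z) := by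
  induction x using ind; induction y using ind; induction z using ind
  exact mk_eq (.sup_add _ _ _)

instance instIsOrderedAddMonoid : IsOrderedAddMonoid (Upsilon G) where
  add_le_add_left x y h z := by
    rw [← sup_eq_right] at h ⊢
    exact (sup_add' x y z).symm.trans (congrArg (· + z) h)

theorem of_add (a b : G) : mk (.of (a + b)) = mk (.of a) + mk (.of b) := mk_eq (.of_add a b)

theorem of_nonneg {a : G} (h : 0 ≤ a) : 0 ≤ mk (.of a) := by
  rw [← sup_eq_right]
  exact mk_eq (.of_nonneg a h)

/-- The generators, as an additive homomorphism. -/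
def ofHom : G →+ Upsilon G := AddMonoidHom.mk' (fun a => mk (.of a)) of_add

theorem ofHom_mono {a b : G} (h : a ≤ b) : ofHom a ≤ ofHom b := by
  have h1 : 0 ≤ ofHom (b - a) := of_nonneg (sub_nonneg.2 h)
  rw [map_sub] at h1
  exact sub_nonneg.1 h1

theorem boundedBy (x : Upsilon G) : BoundedBy (ofHom (unit : G)) x := by
  have h0 : 0 ≤ ofHom (unit : G) := of_nonneg unit_nonneg
  induction x using ind with | h t =>
  induction t with
  | of a =>
    obtain ⟨n, h1, h2⟩ := boundedBy_unit a
    refine ⟨n, ?_, ?_⟩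
    · have := ofHom_mono h1
      rwa [map_neg, map_nsmul] at this
    · have := ofHom_mono h2
      rwa [map_nsmul] at this
  | zero => exact BoundedBy.zero _
  | add s t hs ht => exact BoundedBy.add hs ht
  | neg t ht => exact BoundedBy.neg ht
  | sup s t hs ht => exact BoundedBy.sup h0 hs ht
  | inf s t hs ht => exact BoundedBy.inf h0 hs ht

instance instUnitalLGroup : UnitalLGroup (Upsilon G) where
  unit := ofHom unit
  unit_nonneg := of_nonneg unit_nonneg
  exists_le_nsmul_unit x := by
    obtain ⟨n, -, h⟩ := boundedBy x
    exact ⟨n, h⟩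

/-- The constructed universal state. -/
def state (a : G) : Upsilon G := ofHom a

/-- Evaluation of terms along a map. -/
def eval {H : Type v} [UnitalLGroup H] (s : G → H) : LTerm G → H
  | .of a => s a
  | .zero => 0
  | .add x y => eval s x + eval s y
  | .neg x => -eval s x
  | .sup x y => eval s x ⊔ eval s y
  | .inf x y => eval s x ⊓ eval s y

theorem eval_eq {H : Type v} [UnitalLGroup H] {s : G → H} (hs : IsState s) {x y : LTerm G}
    (h : LTerm.Rel x y) : eval s x = eval s y := by
  induction h with
  | refl => rfl
  | symm _ ih => exact ih.symm
  | trans _ _ ih1 ih2 => exact ih1.trans ih2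
  | add_congr _ _ ih1 ih2 => simp only [eval, ih1, ih2]
  | neg_congr _ ih => simp only [eval, ih]
  | sup_congr _ _ ih1 ih2 => simp only [eval, ih1, ih2]
  | inf_congr _ _ ih1 ih2 => simp only [eval, ih1, ih2]
  | add_assoc => exact _root_.add_assoc _ _ _
  | add_comm => exact _root_.add_comm _ _
  | zero_add => exact _root_.zero_add _
  | neg_add => exact neg_add_cancel _
  | sup_comm => exact _root_.sup_comm _ _
  | sup_assoc => exact _root_.sup_assoc _ _ _
  | inf_comm => exact _root_.inf_comm _ _
  | inf_assoc => exact _root_.inf_assoc _ _ _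
  | sup_inf_self => exact _root_.sup_inf_self
  | inf_sup_self => exact _root_.inf_sup_self
  | sup_add => exact _root_.sup_add _ _ _
  | of_add a b => exact hs.map_add a b
  | of_nonneg a ha => exact sup_eq_right.2 (hs.map_nonneg a ha)

theorem isUniversalState_state : IsUniversalState (state (G := G)) where
  isState := ⟨of_add, rfl, fun _ h => of_nonneg h⟩
  existsUnique_hom H _ s hs := by
    refine ⟨Quot.lift (eval s) fun _ _ h => eval_eq hs h, ⟨⟨?_, ?_, ?_, hs.map_unit⟩,
      fun _ => rfl⟩, ?_⟩
    · intro x y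
      induction x using ind; induction y using ind
      rfl
    · intro x y
      induction x using ind; induction y using ind
      rfl
    · intro x y
      induction x using ind; induction y using ind
      rfl
    · rintro k ⟨hk, hks⟩
      have k0 : k 0 = 0 := by simpa using hk.map_add 0 0
      funext x
      induction x using ind with | h t =>
      induction t with
      | of a => exact hks a
      | zero => exact k0
      | add x y hx hy => exact (hk.map_add (mk x) (mk y)).trans (congrArg₂ _ hx hy)
      | neg x hx =>
        have h := hk.map_add (-mk x) (mk x)
        rw [neg_add_cancel, k0] at h
        exact (eq_neg_of_add_eq_zero_left h.symm).trans (congrArg _ hx)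
      | sup x y hx hy => exact (hk.map_sup (mk x) (mk y)).trans (congrArg₂ _ hx hy)
      | inf x y hx hy => exact (hk.map_inf (mk x) (mk y)).trans (congrArg₂ _ hx hy)

end Upsilon

end UnitalLGroup

/-! The comparison map is always onto, since its image is a sublattice-subgroup containing every
`hat a`. So the question is injectivity. A group of real functions is Archimedean, and the property
descends along injective unital ℓ-homomorphisms; this settles one direction.

Conversely, let `U` be Archimedean and `z` not `≤ 0`. Some real-valued unital ℓ-homomorphism `φ` has
`φ z > 0` (`IsArchimedean.exists_isUnitalLHom_pos`). Then `φ ∘ υ` is a point of the state space, and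
universality forces `φ` to be the comparison map followed by evaluation there, so `z` is not in the
kernel.

To obtain `φ`, Zorn's lemma gives an ideal maximal among those avoiding a suitable `c > 0`. It is
prime, so the quotient is totally ordered, and Hölder's rational cuts map the quotient to `ℝ`. -/

namespace UnitalLGroup

/-! ### Prime ideals and total preorders from Zorn's lemma. -/

section PositiveIdeals

variable {L : Type w} [AddCommGroup L] [Lattice L]

/-- The positive part of an ℓ-ideal. -/
structure IsPosIdeal (I : Set L) : Prop where
  nonneg : ∀ a ∈ I, 0 ≤ a
  zero_mem : (0 : L) ∈ I
  add_mem : ∀ a ∈ I, ∀ b ∈ I, a + b ∈ I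
  mem_of_le : ∀ a b, 0 ≤ a → a ≤ b → b ∈ I → a ∈ I

/-- A cone whose associated preorder is total and compatible with the lattice operations. -/
structure IsPrimeCone (T : Set L) : Prop where
  mem_of_nonneg : ∀ a, 0 ≤ a → a ∈ T
  add_mem : ∀ a ∈ T, ∀ b ∈ T, a + b ∈ T
  inf_mem : ∀ a ∈ T, ∀ b ∈ T, a ⊓ b ∈ T
  total : ∀ a, a ∈ T ∨ -a ∈ T

theorem IsPosIdeal.nsmul_mem {I : Set L} (hI : IsPosIdeal I) {a : L} (ha : a ∈ I) (n : ℕ) :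
    n • a ∈ I := by
  induction n with
  | zero => simpa using hI.zero_mem
  | succ n ih => rw [succ_nsmul]; exact hI.add_mem _ ih _ ha

theorem IsPrimeCone.nsmul_mem {T : Set L} (hT : IsPrimeCone T) {a : L} (ha : a ∈ T) (n : ℕ) :
    n • a ∈ T := by
  induction n with
  | zero => simpa using hT.mem_of_nonneg 0 le_rfl
  | succ n ih => rw [succ_nsmul]; exact hT.add_mem _ ih _ ha

theorem exists_maximal_posIdeal {c : L} (hc0 : c ≠ 0) :
    ∃ I : Set L, Maximal (fun J => IsPosIdeal J ∧ c ∉ J) I := by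
  refine (zorn_subset_nonempty {J : Set L | IsPosIdeal J ∧ c ∉ J} ?_ {0} ?_).imp fun _ h => h.2
  · rintro C hC hch ⟨J₀, hJ₀⟩
    refine ⟨⋃₀ C, ⟨⟨?_, ?_, ?_, ?_⟩, ?_⟩, fun J hJ => Set.subset_sUnion_of_mem hJ⟩
    · rintro a ⟨J, hJ, h⟩
      exact (hC hJ).1.nonneg a h
    · exact ⟨J₀, hJ₀, (hC hJ₀).1.zero_mem⟩
    · rintro a ⟨J, hJ, ha⟩ b ⟨K, hK, hb⟩
      rcases hch.total hJ hK with h | h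
      · exact ⟨K, hK, (hC hK).1.add_mem _ (h ha) _ hb⟩
      · exact ⟨J, hJ, (hC hJ).1.add_mem _ ha _ (h hb)⟩
    · rintro a b ha hab ⟨J, hJ, hb⟩
      exact ⟨J, hJ, (hC hJ).1.mem_of_le a b ha hab hb⟩
    · rintro ⟨J, hJ, h⟩
      exact (hC hJ).2 h
  · refine ⟨⟨?_, rfl, ?_, ?_⟩, hc0⟩
    · rintro a rfl; exact le_rfl
    · rintro a rfl b rfl; exact add_zero _
    · rintro a b ha hab rfl; exact le_antisymm hab ha

variable [IsOrderedAddMonoid L]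

/-- Translation distributes over meets, so the right side is a meet of four sums, each bounded below
by the left side. Hence disjointness passes to multiples. -/
theorem inf_add_le_add_inf {a b c : L} (ha : 0 ≤ a) (hb : 0 ≤ b) (hc : 0 ≤ c) :
    a ⊓ (b + c) ≤ a ⊓ b + a ⊓ c := by
  rw [inf_add, add_inf, add_inf]
  refine le_inf (le_inf ?_ ?_) (le_inf ?_ inf_le_right)
  · exact inf_le_left.trans (le_add_of_nonneg_right ha)
  · exact inf_le_left.trans (le_add_of_nonneg_right hc)
  · exact inf_le_left.trans (le_add_of_nonneg_left hb)

theorem inf_nsmul_eq_zero {a b : L} (ha : 0 ≤ a) (hb : 0 ≤ b) (h : a ⊓ b = 0) (n : ℕ) :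
    a ⊓ n • b = 0 := by
  induction n with
  | zero => simpa using ha
  | succ n ih =>
    refine le_antisymm ?_ (le_inf ha (nsmul_nonneg hb _))
    rw [succ_nsmul]
    exact (inf_add_le_add_inf ha (nsmul_nonneg hb n) hb).trans (by rw [ih, h, add_zero])

/-- The positive ideal generated by a positive ideal and an element. -/
theorem IsPosIdeal.adjoin {I : Set L} (hI : IsPosIdeal I) (a : L) :
    IsPosIdeal {x : L | 0 ≤ x ∧ ∃ p ∈ I, ∃ n : ℕ, x ≤ p + n • a} where
  nonneg _ h := h.1
  zero_mem := ⟨le_rfl, 0, hI.zero_mem, 0, by simp⟩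
  add_mem := by
    rintro x ⟨hx, p, hp, n, h⟩ y ⟨hy, q, hq, m, k⟩
    refine ⟨add_nonneg hx hy, p + q, hI.add_mem _ hp _ hq, n + m, (add_le_add h k).trans_eq ?_⟩
    rw [add_nsmul]; abel
  mem_of_le := by
    rintro x y hx hxy ⟨-, p, hp, n, h⟩
    exact ⟨hx, p, hp, n, hxy.trans h⟩

/-- Primeness: if both memberships failed, `c` would lie below `p + n • a` and `q + m • b`, hence
below `p + q + (n • a ⊓ m • b) = p + q`, an element of `I`. -/
theorem mem_or_mem_of_maximal {I : Set L} {c : L} (hc : 0 ≤ c)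
    (hI : Maximal (fun J => IsPosIdeal J ∧ c ∉ J) I) {a b : L} (ha : 0 ≤ a) (hb : 0 ≤ b)
    (hab : a ⊓ b = 0) : a ∈ I ∨ b ∈ I := by
  -- By maximality, adjoining an element outside `I` captures `c`.
  have key : ∀ a : L, 0 ≤ a → a ∉ I → ∃ p ∈ I, ∃ n : ℕ, c ≤ p + n • a := by
    intro a ha haI
    by_contra hcon
    refine haI (hI.2 ⟨hI.1.1.adjoin a, fun h => hcon h.2⟩ (fun x hx => ?_)
      ⟨ha, 0, hI.1.1.zero_mem, 1, by simp⟩)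
    exact ⟨hI.1.1.nonneg x hx, x, hx, 0, by simp⟩
  by_contra! h
  obtain ⟨p, hp, n, hn⟩ := key a ha h.1
  obtain ⟨q, hq, m, hm⟩ := key b hb h.2
  have h0 : n • a ⊓ m • b = 0 := by
    refine inf_nsmul_eq_zero (nsmul_nonneg ha n) hb ?_ m
    rw [inf_comm]
    exact inf_nsmul_eq_zero hb ha (by rwa [inf_comm]) n
  refine hI.1.2 (hI.1.1.mem_of_le c (p + q) hc ?_ (hI.1.1.add_mem _ hp _ hq))
  calc c ≤ (p + q + n • a) ⊓ (p + q + m • b) := by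
        refine le_inf (hn.trans ?_) (hm.trans ?_)
        · exact add_le_add_left (le_add_of_nonneg_right (hI.1.1.nonneg q hq)) _
        · exact add_le_add_left (le_add_of_nonneg_left (hI.1.1.nonneg p hp)) _
    _ = p + q := by rw [← add_inf, h0, add_zero]

/-- `a⁻ ∈ I` means that `a` is nonnegative modulo the ideal. Both `(a + b)⁻` and `(a ⊓ b)⁻` lie
below `a⁻ + b⁻`; totality is primeness applied to the disjoint pair `a⁺`, `a⁻`. -/
theorem isPrimeCone_of_maximal {I : Set L} {c : L} (hc : 0 ≤ c)
    (hI : Maximal (fun J => IsPosIdeal J ∧ c ∉ J) I) : IsPrimeCone {a : L | a⁻ ∈ I} where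
  mem_of_nonneg a ha := by
    rw [Set.mem_ofPred_eq, negPart_eq_zero.2 ha]
    exact hI.1.1.zero_mem
  add_mem a ha b hb := by
    refine hI.1.1.mem_of_le _ _ (negPart_nonneg _) ?_ (hI.1.1.add_mem _ ha _ hb)
    refine sup_le ?_ (add_nonneg (negPart_nonneg a) (negPart_nonneg b))
    rw [neg_add]
    exact add_le_add (neg_le_negPart a) (neg_le_negPart b)
  inf_mem a ha b hb := by
    refine hI.1.1.mem_of_le _ _ (negPart_nonneg _) ?_ (hI.1.1.add_mem _ ha _ hb)
    refine sup_le ?_ (add_nonneg (negPart_nonneg a) (negPart_nonneg b))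
    rw [neg_inf]
    exact sup_le ((neg_le_negPart a).trans (le_add_of_nonneg_right (negPart_nonneg b)))
      ((neg_le_negPart b).trans (le_add_of_nonneg_left (negPart_nonneg a)))
  total a := by
    have h := mem_or_mem_of_maximal hc hI (posPart_nonneg a) (negPart_nonneg a)
      (posPart_inf_negPart_eq_zero a)
    rw [Set.mem_ofPred_eq, Set.mem_ofPred_eq, negPart_neg]
    exact h.symm

end PositiveIdeals

/-! ### Hölder's theorem: real values from a total preorder. -/

section Hoelder

variable {U : Type u} [UnitalLGroup U] {T : Set U}

/-- The lower cut of rationals `p / q` with `p • unit ≤ q • a` modulo the cone `T`. -/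
def lowerCut (T : Set U) (a : U) : Set ℝ :=
  {r | ∃ (p : ℤ) (q : ℕ), 0 < q ∧ r = p / q ∧ q • a - p • (unit : U) ∈ T}

/-- The supremum of the lower cut. -/
noncomputable def coneValue (T : Set U) (a : U) : ℝ := sSup (lowerCut T a)

theorem lowerCut_add (hT : IsPrimeCone T) {a b : U} {r s : ℝ} (hr : r ∈ lowerCut T a)
    (hs : s ∈ lowerCut T b) : r + s ∈ lowerCut T (a + b) := by
  obtain ⟨p, q, hq, rfl, h⟩ := hr
  obtain ⟨p', q', hq', rfl, h'⟩ := hs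
  refine ⟨p * q' + p' * q, q * q', Nat.mul_pos hq hq', ?_, ?_⟩
  · have : (q : ℝ) ≠ 0 := by positivity
    have : (q' : ℝ) ≠ 0 := by positivity
    push_cast
    field_simp
  · convert hT.add_mem _ (hT.nsmul_mem h q') _ (hT.nsmul_mem h' q) using 1
    simp only [← natCast_zsmul]
    push_cast
    module

theorem intCast_nonpos_of_mem (hT : IsPrimeCone T) (h1 : -(unit : U) ∉ T) {p : ℤ}
    (h : -(p • (unit : U)) ∈ T) : p ≤ 0 := by
  by_contra! hp
  refine h1 ?_
  -- For `p ≥ 1`, adding `(p - 1) • unit` to `-(p • unit)` would put `-unit` in `T`.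
  have h2 : 0 ≤ (p - 1).toNat • (unit : U) := nsmul_nonneg unit_nonneg _
  convert hT.add_mem _ h _ (hT.mem_of_nonneg _ h2) using 1
  rw [← natCast_zsmul, Int.toNat_of_nonneg (by omega)]
  module

theorem nonpos_of_mem_lowerCut_zero (hT : IsPrimeCone T) (h1 : -(unit : U) ∉ T) {r : ℝ}
    (hr : r ∈ lowerCut T 0) : r ≤ 0 := by
  obtain ⟨p, q, hq, rfl, h⟩ := hr
  rw [nsmul_zero, zero_sub] at h
  have : (p : ℝ) ≤ 0 := by exact_mod_cast intCast_nonpos_of_mem hT h1 h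
  exact div_nonpos_of_nonpos_of_nonneg this (by positivity)

theorem add_nonpos_of_mem_lowerCut (hT : IsPrimeCone T) (h1 : -(unit : U) ∉ T) {a : U} {r s : ℝ}
    (hr : r ∈ lowerCut T a) (hs : s ∈ lowerCut T (-a)) : r + s ≤ 0 :=
  nonpos_of_mem_lowerCut_zero hT h1 (by simpa using lowerCut_add hT hr hs)

theorem lowerCut_nonempty (hT : IsPrimeCone T) (a : U) : (lowerCut T a).Nonempty := by
  obtain ⟨n, h, -⟩ := boundedBy_unit a
  refine ⟨_, -n, 1, one_pos, rfl, hT.mem_of_nonneg _ ?_⟩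
  rw [one_nsmul, neg_zsmul, natCast_zsmul]
  exact sub_nonneg.2 h

/-- With nonemptiness, this makes the `sSup` in `coneValue` a genuine supremum rather than a default
value. Any element of the cut of `-a`, negated, is a bound. -/
theorem bddAbove_lowerCut (hT : IsPrimeCone T) (h1 : -(unit : U) ∉ T) (a : U) :
    BddAbove (lowerCut T a) := by
  obtain ⟨s, hs⟩ := lowerCut_nonempty hT (-a)
  exact ⟨-s, fun r hr => by linarith [add_nonpos_of_mem_lowerCut hT h1 hr hs]⟩

theorem le_coneValue (hT : IsPrimeCone T) (h1 : -(unit : U) ∉ T) {a : U} {r : ℝ}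
    (hr : r ∈ lowerCut T a) : r ≤ coneValue T a :=
  le_csSup (bddAbove_lowerCut hT h1 a) hr

theorem coneValue_neg (hT : IsPrimeCone T) (h1 : -(unit : U) ∉ T) (a : U) :
    coneValue T (-a) = -coneValue T a := by
  apply le_antisymm
  · refine csSup_le (lowerCut_nonempty hT _) fun s hs => ?_
    rw [le_neg]
    exact csSup_le (lowerCut_nonempty hT _) fun r hr => by
      linarith [add_nonpos_of_mem_lowerCut hT h1 hr hs]
  · by_contra! h
    -- A rational in the gap is impossible: by totality `r` lies in the cut of `a` or `-r` in the
    -- cut of `-a`.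
    obtain ⟨r, hr1, hr2⟩ := exists_rat_btwn (lt_neg.2 h)
    have hq : (r : ℝ) = (r.num : ℝ) / (r.den : ℝ) := by exact_mod_cast (Rat.num_div_den r).symm
    rcases hT.total (r.den • a - r.num • (unit : U)) with hm | hm
    · exact absurd (le_coneValue hT h1 ⟨r.num, r.den, r.den_pos, hq, hm⟩) (not_le.2 hr1)
    · have hm' : -(r : ℝ) ∈ lowerCut T (-a) := by
        refine ⟨-r.num, r.den, r.den_pos, by rw [hq]; push_cast; ring, ?_⟩
        convert hm using 1
        simp only [← natCast_zsmul]
        module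
      linarith [le_coneValue hT h1 hm']

theorem add_le_coneValue (hT : IsPrimeCone T) (h1 : -(unit : U) ∉ T) (a b : U) :
    coneValue T a + coneValue T b ≤ coneValue T (a + b) := by
  rw [← le_sub_iff_add_le]
  refine csSup_le (lowerCut_nonempty hT _) fun r hr => ?_
  rw [le_sub_comm]
  refine csSup_le (lowerCut_nonempty hT _) fun s hs => ?_
  linarith [le_coneValue hT h1 (lowerCut_add hT hr hs)]

/-- A superadditive odd function is additive. -/
theorem coneValue_add (hT : IsPrimeCone T) (h1 : -(unit : U) ∉ T) (a b : U) :
    coneValue T (a + b) = coneValue T a + coneValue T b := by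
  refine le_antisymm ?_ (add_le_coneValue hT h1 a b)
  have h := add_le_coneValue hT h1 (-a) (-b)
  rw [← neg_add, coneValue_neg hT h1, coneValue_neg hT h1, coneValue_neg hT h1] at h
  linarith

theorem coneValue_sub (hT : IsPrimeCone T) (h1 : -(unit : U) ∉ T) (a b : U) :
    coneValue T (a - b) = coneValue T a - coneValue T b := by
  rw [sub_eq_add_neg, coneValue_add hT h1, coneValue_neg hT h1, sub_eq_add_neg]

theorem coneValue_nonneg (hT : IsPrimeCone T) (h1 : -(unit : U) ∉ T) {a : U} (ha : a ∈ T) :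
    0 ≤ coneValue T a :=
  le_coneValue hT h1 ⟨0, 1, one_pos, by simp, by simpa using ha⟩

theorem coneValue_unit (hT : IsPrimeCone T) (h1 : -(unit : U) ∉ T) :
    coneValue T (unit : U) = 1 := by
  have h0 := hT.mem_of_nonneg 0 le_rfl
  apply le_antisymm
  · have h : (-1 : ℝ) ≤ coneValue T (-unit) :=
      le_coneValue hT h1 ⟨-1, 1, one_pos, by simp, by simpa using h0⟩
    rw [coneValue_neg hT h1] at h
    linarith
  · exact le_coneValue hT h1 ⟨1, 1, one_pos, by simp, by simpa using h0⟩

/-- Modulo `T`, `b` is below `a`, so `a ⊓ b` and `b` are each below the other and share their value.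
-/
theorem coneValue_inf_of_sub_mem (hT : IsPrimeCone T) (h1 : -(unit : U) ∉ T) {a b : U}
    (h : a - b ∈ T) : coneValue T (a ⊓ b) = coneValue T a ⊓ coneValue T b := by
  have hab := coneValue_nonneg hT h1 h
  have hb : b - a ⊓ b ∈ T := hT.mem_of_nonneg _ (sub_nonneg.2 inf_le_right)
  have hi : a ⊓ b - b ∈ T := by
    rw [inf_sub, sub_self]
    exact hT.inf_mem _ h _ (hT.mem_of_nonneg 0 le_rfl)
  have hb := coneValue_nonneg hT h1 hb
  have hi := coneValue_nonneg hT h1 hi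
  rw [coneValue_sub hT h1] at hab hb hi
  rw [inf_eq_right.2 (sub_nonneg.1 hab)]
  linarith

theorem coneValue_inf (hT : IsPrimeCone T) (h1 : -(unit : U) ∉ T) (a b : U) :
    coneValue T (a ⊓ b) = coneValue T a ⊓ coneValue T b := by
  rcases hT.total (a - b) with h | h
  · exact coneValue_inf_of_sub_mem hT h1 h
  · rw [inf_comm a, inf_comm (coneValue T a)]
    exact coneValue_inf_of_sub_mem hT h1 (by rwa [neg_sub] at h)

theorem isUnitalLHom_coneValue (hT : IsPrimeCone T) (h1 : -(unit : U) ∉ T) :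
    IsUnitalLHom (coneValue T) where
  map_add := coneValue_add hT h1
  map_inf := coneValue_inf hT h1
  map_sup a b := by
    have h := coneValue_add hT h1 (a ⊓ b) (a ⊔ b)
    rw [inf_add_sup, coneValue_add hT h1, coneValue_inf hT h1] at h
    have h' := inf_add_sup (coneValue T a) (coneValue T b)
    linarith
  map_unit := coneValue_unit hT h1

/-- In an Archimedean unital Abelian ℓ-group, the real-valued unital ℓ-homomorphisms detect the
elements that are not nonpositive. -/
theorem IsArchimedean.exists_isUnitalLHom_pos (hU : IsArchimedean U) {x : U} (hx : ¬x ≤ 0) :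
    ∃ φ : U → ℝ, IsUnitalLHom φ ∧ 0 < φ x := by
  obtain ⟨n, hn, hnx⟩ : ∃ n : ℕ, 0 < n ∧ ¬n • x ≤ unit := by
    by_contra! h
    exact hx (hU x unit h)
  -- This positive part is the element `c` to be avoided; keeping it outside `I` will force `n • x ≥
  -- unit` modulo the cone.
  have hc0 : (n • x - (unit : U))⁺ ≠ 0 := fun h => hnx (sub_nonpos.1 (posPart_eq_zero.1 h))
  have hc := posPart_nonneg (n • x - (unit : U))
  obtain ⟨I, hI⟩ := exists_maximal_posIdeal hc0
  have hT := isPrimeCone_of_maximal hc hI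
  -- Otherwise `unit ∈ I`, and a multiple of the unit dominates `c`.
  have h1 : -(unit : U) ∉ {a : U | a⁻ ∈ I} := by
    intro h
    rw [Set.mem_ofPred_eq, negPart_neg, posPart_eq_self.2 unit_nonneg] at h
    obtain ⟨k, hk⟩ := exists_le_nsmul_unit (n • x - (unit : U))⁺
    exact hI.1.2 (hI.1.1.mem_of_le _ _ hc hk (hI.1.1.nsmul_mem h k))
  refine ⟨_, isUnitalLHom_coneValue hT h1, ?_⟩
  -- The positive and negative parts are disjoint and the positive one is outside `I`, so the
  -- negative one is inside. Thus `1 / n` enters the cut of `x`.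
  have hm : n • x - (unit : U) ∈ {a : U | a⁻ ∈ I} :=
    (mem_or_mem_of_maximal hc hI hc (negPart_nonneg _)
      (posPart_inf_negPart_eq_zero _)).resolve_left hI.1.2
  have h : (1 / n : ℝ) ≤ coneValue {a : U | a⁻ ∈ I} x :=
    le_coneValue hT h1 ⟨1, n, hn, by simp, by simpa using hm⟩
  exact lt_of_lt_of_le (by positivity) h

end Hoelder

/-! ### Unital ℓ-homomorphisms: bijectivity, injectivity, the Archimedean property. -/

section Homomorphisms

variable {G : Type u} {H : Type v} [UnitalLGroup G] [UnitalLGroup H] {h : G → H}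

theorem IsUnitalLHom.map_zero (hh : IsUnitalLHom h) : h 0 = 0 := by
  simpa using hh.map_add 0 0

theorem IsUnitalLHom.mono (hh : IsUnitalLHom h) {a b : G} (hab : a ≤ b) : h a ≤ h b := by
  rw [← sup_eq_right, ← hh.map_sup, sup_eq_right.2 hab]

theorem IsUnitalLHom.isState (hh : IsUnitalLHom h) : IsState h where
  map_add := hh.map_add
  map_unit := hh.map_unit
  map_nonneg a ha := by simpa [hh.map_zero] using hh.mono ha

theorem IsState.comp {K : Type w} [UnitalLGroup K] {s : G → H} {t : H → K} (ht : IsState t)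
    (hs : IsState s) : IsState fun a => t (s a) where
  map_add a b := by rw [hs.map_add, ht.map_add]
  map_unit := by rw [hs.map_unit, ht.map_unit]
  map_nonneg a ha := ht.map_nonneg _ (hs.map_nonneg a ha)

theorem IsUnitalLHom.comp {K : Type w} [UnitalLGroup K] {k : H → K} (hk : IsUnitalLHom k)
    (hh : IsUnitalLHom h) : IsUnitalLHom fun a => k (h a) where
  map_add a b := by rw [hh.map_add, hk.map_add]
  map_sup a b := by rw [hh.map_sup, hk.map_sup]
  map_inf a b := by rw [hh.map_inf, hk.map_inf]
  map_unit := by rw [hh.map_unit, hk.map_unit]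

theorem IsUnitalLHom.isUnitalLIso (hh : IsUnitalLHom h) (hb : Function.Bijective h) :
    IsUnitalLIso h := by
  obtain ⟨k, hl, hr⟩ := Function.bijective_iff_has_inverse.1 hb
  refine ⟨hh, k, ⟨?_, ?_, ?_, ?_⟩, hl, hr⟩
  · intro a b
    exact hb.1 (by rw [hh.map_add, hr, hr, hr])
  · intro a b
    exact hb.1 (by rw [hh.map_sup, hr, hr, hr])
  · intro a b
    exact hb.1 (by rw [hh.map_inf, hr, hr, hr])
  · exact hb.1 (by rw [hh.map_unit, hr])

theorem IsUnitalLHom.injective_of_forall_le_zero (hh : IsUnitalLHom h)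
    (h0 : ∀ z, h z = 0 → z ≤ 0) : Function.Injective h := by
  have key : ∀ x y, h x = h y → x ≤ y := fun x y hxy => by
    refine sub_nonpos.1 (h0 _ ?_)
    rw [sub_eq_add_neg, hh.map_add, hh.isState.map_neg, hxy, add_neg_cancel]
  exact fun x y hxy => le_antisymm (key x y hxy) (key y x hxy.symm)

/-- `a ≤ 0` is the equation `a ⊔ 0 = 0`, so an injective ℓ-homomorphism reflects it. -/
theorem IsArchimedean.of_injective (hH : IsArchimedean H) (hh : IsUnitalLHom h)
    (hi : Function.Injective h) : IsArchimedean G := by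
  intro a b hab
  have h0 : h a ≤ 0 := hH (h a) (h b) fun n hn => by
    rw [← hh.isState.map_nsmul]
    exact hh.mono (hab n hn)
  rw [← sup_eq_right]
  refine hi ?_
  rw [hh.map_sup, hh.map_zero, sup_eq_right.2 h0]

end Homomorphisms

/-! ### Pointwise evaluation and the Archimedean property of `extAffine G`. -/

section ExtAffineRep

variable {G : Type u} [UnitalLGroup G]

theorem isArchimedean_real : IsArchimedean ℝ := by
  intro a b h
  by_contra! ha
  obtain ⟨n, hn⟩ := exists_nat_gt (b / a)
  have h' := h (n + 1) n.succ_pos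
  rw [div_lt_iff₀ ha] at hn
  rw [nsmul_eq_mul] at h'
  push_cast at h'
  linarith

/-- Evaluation at a real-valued state is a unital ℓ-homomorphism. -/
theorem isUnitalLHom_eval (s : stateSpace G) :
    IsUnitalLHom fun f : extAffine G => (f : C(stateSpace G, ℝ)) s where
  map_add _ _ := rfl
  map_sup _ _ := rfl
  map_inf _ _ := rfl
  map_unit := rfl

theorem isArchimedean_extAffine : IsArchimedean (extAffine G) := by
  intro f g h s
  refine isArchimedean_real _ (g.1 s) fun n hn => ?_
  have := (isUnitalLHom_eval s).mono (h n hn)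
  rwa [(isUnitalLHom_eval s).isState.map_nsmul] at this

end ExtAffineRep

/-- The lift of a unital Abelian ℓ-group to a larger universe. -/
instance instULift {H : Type u} [UnitalLGroup H] : UnitalLGroup (ULift.{v} H) where
  toAddCommGroup := inferInstance
  toLattice := ULift.down_injective.lattice ULift.down (fun {_ _} => Iff.rfl) (fun {_ _} => Iff.rfl)
    (fun _ _ => rfl) (fun _ _ => rfl)
  add_le_add_left _ _ h k := add_le_add_left (α := H) h k.down
  unit := ⟨unit⟩
  unit_nonneg := unit_nonneg (G := H)
  exists_le_nsmul_unit a := exists_le_nsmul_unit a.down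

theorem isUnitalLHom_up {H : Type u} [UnitalLGroup H] :
    IsUnitalLHom (ULift.up : H → ULift.{v} H) :=
  ⟨fun _ _ => rfl, fun _ _ => rfl, fun _ _ => rfl, rfl⟩

/-! ### Universality and the bijectivity of the comparison map. -/

section Universal

variable {G U : Type u} [UnitalLGroup G] [UnitalLGroup U] {υ : G → U}

/-- Real-valued unital ℓ-homomorphisms on the codomain of a universal state are determined by
their values on the image of the state. -/
theorem IsUniversalState.hom_real_ext (hυ : IsUniversalState υ) {h k : U → ℝ}
    (hh : IsUnitalLHom h) (hk : IsUnitalLHom k) (hhk : ∀ a, h (υ a) = k (υ a)) : h = k := by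
  -- Universality quantifies over targets in `Type u` only, so `ℝ` is lifted there first.
  have hup := isUnitalLHom_up.{0, u} (H := ℝ)
  have he := (hυ.existsUnique_hom (ULift.{u} ℝ) _ ((hup.comp hh).isState.comp hυ.isState)).unique
    ⟨hup.comp hh, fun _ => rfl⟩ ⟨hup.comp hk, fun a => congrArg ULift.up (hhk a).symm⟩
  funext x
  exact congrArg ULift.down (congrFun he x)

theorem surjective_comparison (hυ : IsUniversalState υ) :
    Function.Surjective (comparison hυ) := by
  have hq := isUnitalLHom_comparison hυ
  let K : AddSubgroup C(stateSpace G, ℝ) :=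
    { carrier := {f | ∃ x, (comparison hυ x : C(stateSpace G, ℝ)) = f}
      add_mem' := by
        rintro _ _ ⟨x, rfl⟩ ⟨y, rfl⟩
        exact ⟨x + y, congrArg Subtype.val (hq.map_add x y)⟩
      zero_mem' := ⟨0, congrArg Subtype.val hq.map_zero⟩
      neg_mem' := by
        rintro _ ⟨x, rfl⟩
        exact ⟨-x, congrArg Subtype.val (hq.isState.map_neg x)⟩ }
  intro f
  obtain ⟨x, hx⟩ : (f : C(stateSpace G, ℝ)) ∈ K := by
    refine AddSubgroup.mem_sInf.1 f.2 K ⟨?_, ?_, ?_⟩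
    · rintro _ ⟨x, rfl⟩ _ ⟨y, rfl⟩
      exact ⟨x ⊔ y, congrArg Subtype.val (hq.map_sup x y)⟩
    · rintro _ ⟨x, rfl⟩ _ ⟨y, rfl⟩
      exact ⟨x ⊓ y, congrArg Subtype.val (hq.map_inf x y)⟩
    · exact fun a => ⟨υ a, congrArg Subtype.val (comparison_apply hυ a)⟩
  exact ⟨x, Subtype.ext hx⟩

theorem IsArchimedean.injective_comparison (hU : IsArchimedean U) (hυ : IsUniversalState υ) :
    Function.Injective (comparison hυ) := by
  have hq := isUnitalLHom_comparison hυ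
  refine hq.injective_of_forall_le_zero fun z hz => ?_
  by_contra hz0
  obtain ⟨φ, hφ, hpos⟩ := hU.exists_isUnitalLHom_pos hz0
  -- On the image of `υ`, `φ` agrees with the comparison map followed by evaluation at `s`; hence
  -- they agree everywhere.
  let s : stateSpace G := ⟨fun a => φ (υ a), hφ.isState.comp hυ.isState⟩
  have h := hυ.hom_real_ext hφ ((isUnitalLHom_eval s).comp hq) fun a => by
    rw [comparison_apply]
    rfl
  rw [h] at hpos
  simp only [hz] at hpos
  exact lt_irrefl _ hpos

end Universal

end UnitalLGroup

theorem proposition5p1 (G : Type u) [UnitalLGroup G] (U : Type u) [UnitalLGroup U] (υ : G → U)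
    (hυ : UnitalLGroup.IsUniversalState υ) :
    UnitalLGroup.IsUnitalLIso (UnitalLGroup.comparison hυ) ↔ UnitalLGroup.IsArchimedean U := by
  constructor
  · rintro ⟨hq, k, -, hk, -⟩
    exact UnitalLGroup.isArchimedean_extAffine.of_injective hq (Function.LeftInverse.injective hk)
  · intro hU
    exact (UnitalLGroup.isUnitalLHom_comparison hυ).isUnitalLIso
      ⟨hU.injective_comparison hυ, UnitalLGroup.surjective_comparison hυ⟩
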